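/- Let $F$ be a tropical Laurent polynomial in $d\ge 0$ variables, i.e. a formal expression $F=\bigoplus_{m\in I} c_m\odot x^{\odot m}$ over the semiring $(\mathbb R\cup\{\infty\},\min,+)$ with $I\subset\mathbb Z^d$ finite, whose support $\operatorname{supp}(F)=\{m\in I: c_m\ne\infty\}$ is nonempty. It defines the function $F(x)=\min_{m\in\operatorname{supp}(F)}(c_m+m\cdot x)$ on $\mathbb R^d$. Let $\mathcal T(F)\subset\mathbb R^d$ be its tropical hypersurface, the set of points $x$ at which this minimum is attained by at least two elements $m\in\operatorname{supp}(F)$. Let $$\operatorname{dome}(F)=\{(p,s)\in\mathbb R^d\times\mathbb R: s\le F(p)\}$$ be the dome of $F$, and let $$U(F)=U(\operatorname{supp}F,c)=\operatorname{conv}\{(m,c_m): m\in\operatorname{supp}(F)\}+\mathbb R_{\ge 0}\,(0,1)\subset\mathbb R^d\times\mathbb R$$ be its extended Newton polyhedron. The normal complex of $F$ consists of the cells in $\mathbb R^d$ obtained from the nonempty proper faces of $\operatorname{dome}(F)$ by omitting the last coordinate; the regular subdivision $\Sigma(F)$ of $\operatorname{supp}(F)$ consists of the cells obtained from the nonempty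 bounded faces of $U(F)$ by omitting the last coordinate. All sets of faces and cells are ordered by inclusion. Then there is an inclusion-reversing bijection $\Phi$ (reversing inclusions in both directions) from the poset of nonempty faces of $\operatorname{dome}(F)$, the dome itself included, to the poset of bounded faces of $U(F)$, the empty face included. (Hence $\Phi(\operatorname{dome}(F))=\emptyset$, and $\Phi$ restricts to an inclusion-reversing bijection between the nonempty proper faces of the dome and the nonempty bounded faces of $U(F)$.) Consequently $\mathcal T(F)$ is dual to $\Sigma(F)$ in the following sense. By omitting the last coordinate, $\Phi$ induces an inclusion-reversing bijection $\sigma\mapsto\sigma^*$ from the cells of the normal complex to the cells of $\Sigma(F)$, with $\dim\sigma+\dim\sigma^*=d$ and with $\sigma$ and $\sigma^*$ orthogonal, i.e. $(u-v)\cdot(x-y)=0$ for all $x,y\in\sigma$ and $u,v\in\sigma^*$. The hypersurface $\mathcal T(F)$ is the union of the cells of dimension less than $d$ of the normal complex, and a cell $\sigma$ of the normal complex is contained in $\mathcal T(F)$ if and only if $\dim\sigma^*\ge 1$. -/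

import Mathlib

open scoped Pointwise

/-- Formal tropical (Laurent) polynomials in `d` variables: formal linear combinations of finitely
many monomials with exponents in `ℤ^d` and coefficients in the tropical semiring
`𝕋 = (ℝ ∪ {∞}, min, +)`. The zero of `Tropical (WithTop ℝ)` is `∞`, so `supp F` is the set of the
exponents whose coefficient is different from `∞`. -/
abbrev TropPoly (d : ℕ) : Type := AddMonoidAlgebra (Tropical (WithTop ℝ)) (Fin d → ℤ)

namespace TropPoly

/-- The support of `F`. -/
def supp {d : ℕ} (F : TropPoly d) : Finset (Fin d → ℤ) := Finsupp.support F.coeff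

/-- An integer exponent vector as a point of `ℝ^d`. -/
def toPoint {d : ℕ} (m : Fin d → ℤ) : Fin d → ℝ := fun i => (m i : ℝ)

/-- The value `c_m ⊙ x^{⊙ m} = c_m + m · x` of a term of `F`. -/
noncomputable def term {d : ℕ} (F : TropPoly d) (m : Fin d → ℤ) (x : Fin d → ℝ) : Tropical (WithTop ℝ) :=
  F.coeff m * Tropical.trop ((toPoint m ⬝ᵥ x : ℝ) : WithTop ℝ)

/-- The function `F(x) = ⨁_m c_m ⊙ x^{⊙ m} = min_m (c_m + m · x)`. The sum is tropical. -/
noncomputable def eval {d : ℕ} (F : TropPoly d) (x : Fin d → ℝ) : Tropical (WithTop ℝ) :=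
  ∑ m ∈ F.supp, F.term m x

/-- The tropical hypersurface: the points where the minimum is attained at least twice. -/
def hypersurface {d : ℕ} (F : TropPoly d) : Set (Fin d → ℝ) :=
  {x | ∃ m ∈ F.supp, ∃ m' ∈ F.supp, m ≠ m' ∧ F.term m x = F.eval x ∧ F.term m' x = F.eval x}

/-- The dome `{(p, s) | s ≤ F(p)}` in `ℝ^d × ℝ`. -/
def dome {d : ℕ} (F : TropPoly d) : Set ((Fin d → ℝ) × ℝ) :=
  {q | (q.2 : WithTop ℝ) ≤ Tropical.untrop (F.eval q.1)}

/-- The coefficient of an exponent in the support, as a real number (on the support the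
coefficient is not `∞`, so the default value `0` is not used). -/
noncomputable def realCoeff {d : ℕ} (F : TropPoly d) (m : F.supp) : ℝ :=
  (Tropical.untrop (F.coeff (m : Fin d → ℤ))).untopD 0

end TropPoly

/-- The polyhedron `U(A, ht) = conv {(a, ht a) | a ∈ A} + ℝ_{≥ 0} (0, 1)` of a point
configuration `A = (a i)_i` in `ℝ^d` with height function `ht`. -/
def extPolyhedron {d : ℕ} {ι : Type} (a : ι → Fin d → ℝ) (ht : ι → ℝ) :
    Set ((Fin d → ℝ) × ℝ) :=
  convexHull ℝ (Set.range fun i => (a i, ht i)) + {z | z.1 = 0 ∧ 0 ≤ z.2}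

/-- The cells of the regular subdivision of the configuration `a` induced by `ht`: the projections
to `ℝ^d` of the (nonempty) bounded faces of `U(A, ht)`. -/
def regularSubdivision {d : ℕ} {ι : Type} (a : ι → Fin d → ℝ) (ht : ι → ℝ) :
    Set (Set (Fin d → ℝ)) :=
  {τ | ∃ H : Set ((Fin d → ℝ) × ℝ), IsExposed ℝ (extPolyhedron a ht) H ∧ H.Nonempty ∧
    Bornology.IsBounded H ∧ τ = Prod.fst '' H}

/-- The dimension of (the affine hull of) a nonempty subset of `ℝ^d`. -/
noncomputable def cellDim {d : ℕ} (σ : Set (Fin d → ℝ)) : ℕ :=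
  Module.finrank ℝ (vectorSpan ℝ σ)

namespace TropPoly

/-- The extended Newton polyhedron `U(supp F, c)`. -/
def extNewton {d : ℕ} (F : TropPoly d) : Set ((Fin d → ℝ) × ℝ) :=
  extPolyhedron (fun m : F.supp => toPoint (m : Fin d → ℤ)) F.realCoeff

/-- The cells of the regular subdivision `Σ(F)` of the support of `F`. -/
def subdivision {d : ℕ} (F : TropPoly d) : Set (Set (Fin d → ℝ)) :=
  regularSubdivision (fun m : F.supp => toPoint (m : Fin d → ℤ)) F.realCoeff

/-- The cells of the normal complex of `F`: the projections to `ℝ^d` of the (nonempty) faces in the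
boundary of the dome, that is, of its nonempty proper faces. -/
def normalComplex {d : ℕ} (F : TropPoly d) : Set (Set (Fin d → ℝ)) :=
  {σ | ∃ G : Set ((Fin d → ℝ) × ℝ), IsExposed ℝ F.dome G ∧ G.Nonempty ∧ G ≠ F.dome ∧
    σ = Prod.fst '' G}

/-- The nonempty faces of the dome (the dome itself included), ordered by inclusion. -/
abbrev DomeFace {d : ℕ} (F : TropPoly d) : Type :=
  {G : Set ((Fin d → ℝ) × ℝ) // IsExposed ℝ F.dome G ∧ G.Nonempty}

/-- The bounded faces of the extended Newton polyhedron (the empty face included), ordered by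
inclusion. -/
abbrev BoundedNewtonFace {d : ℕ} (F : TropPoly d) : Type :=
  {H : Set ((Fin d → ℝ) × ℝ) // IsExposed ℝ F.extNewton H ∧ Bornology.IsBounded H}

end TropPoly

/-! Everything is governed by the set `argmin a c p` of terms that attain the minimum at `p`. Each
`p` determines two faces: `domeFace a c p`, the points of the dome at which all these terms are
tight, and `lowerFace a c p`, the convex hull of the lifted exponents of these terms. Enlarging
`argmin a c p` imposes more equations on the first and adds generators to the second, so inclusions
are reversed (`domeFace_subset_iff`, `lowerFace_subset_iff`).

Every nonempty proper face of the dome is some `domeFace a c p` (`eq_dome_or_eq_domeFace`), and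
every nonempty bounded face of the extended polyhedron is some `lowerFace a c p`
(`exists_eq_lowerFace`). Two posets parametrized by the same points with opposite orders are
anti-isomorphic; the dome and the empty face form one extra pair. The comparisons survive
projection, which gives the bijection of cells.

The cell of `p` is the set of `q` with `argmin a c p ⊆ argmin a c q`. Near `p` it is cut out by the
equality of the terms minimal at `p`, so its direction space is the orthogonal complement of that of
the dual cell. This yields orthogonality and complementary dimensions. A point lies on the
hypersurface exactly when its argmin has at least two elements, that is, when its dual cell has
positive dimension. -/

/-- Two posets parametrized order-compatibly by the same type are isomorphic. -/
theorem exists_orderIso_of_parametrization {κ α β : Type*} [PartialOrder α] [PartialOrder β]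
    (f : κ → α) (g : κ → β) (hf : Function.Surjective f) (hg : Function.Surjective g)
    (h : ∀ i j, f i ≤ f j ↔ g i ≤ g j) : ∃ e : α ≃o β, ∀ i, e (f i) = g i := by
  have hmono : ∀ x y, g (Function.surjInv hf x) ≤ g (Function.surjInv hf y) ↔ x ≤ y := by
    intro x y
    rw [← h, Function.surjInv_eq hf x, Function.surjInv_eq hf y]
  -- By antisymmetry, `f i = f j` forces `g i = g j`, so the chosen preimage is immaterial and
  -- neither parametrization needs to be injective.
  have key : ∀ i, g (Function.surjInv hf (f i)) = g i := fun i =>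
    le_antisymm ((h _ _).1 (Function.surjInv_eq hf _).le)
      ((h _ _).1 (Function.surjInv_eq hf _).ge)
  refine ⟨RelIso.ofSurjective (OrderEmbedding.ofMapLEIff
    (fun x => g (Function.surjInv hf x)) hmono) fun y => ?_, fun i => key i⟩
  obtain ⟨i, rfl⟩ := hg y
  exact ⟨f i, key i⟩

/-! ### Linear functionals on convex hulls and orthogonal complements -/

/-- The face of a convex hull on which a linear functional attains a lower bound is spanned by
the generators at which it is attained. -/
theorem mem_convexHull_of_apply_eq {E : Type*} [AddCommGroup E] [Module ℝ E] {P : Set E}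
    (f : E →ₗ[ℝ] ℝ) {r : ℝ} (hr : ∀ x ∈ P, r ≤ f x) {x : E} (hx : x ∈ convexHull ℝ P)
    (hfx : f x = r) : x ∈ convexHull ℝ {y ∈ P | f y = r} := by
  -- With strictly positive weights, a convex combination attains the bound only if both endpoints
  -- do.
  have hconv : Convex ℝ {y | r ≤ f y ∧ (f y = r → y ∈ convexHull ℝ {y ∈ P | f y = r})} := by
    rw [convex_iff_forall_pos]
    rintro y ⟨hy, hy'⟩ z ⟨hz, hz'⟩ s t hs ht hst
    have e : f (s • y + t • z) = s * f y + t * f z := by simp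
    have e' : s * f y + t * f z - r = s * (f y - r) + t * (f z - r) := by
      linear_combination r * hst
    have h1 := mul_nonneg hs.le (sub_nonneg.2 hy)
    have h2 := mul_nonneg ht.le (sub_nonneg.2 hz)
    refine ⟨by linarith, fun h => ?_⟩
    have h3 : s * (f y - r) = 0 := by linarith
    have h4 : t * (f z - r) = 0 := by linarith
    have h5 := (mul_eq_zero.1 h3).resolve_left hs.ne'
    have h6 := (mul_eq_zero.1 h4).resolve_left ht.ne'
    exact convex_convexHull ℝ _ (hy' (by linarith)) (hz' (by linarith)) hs.le ht.le hst
  have hsub : P ⊆ {y | r ≤ f y ∧ (f y = r → y ∈ convexHull ℝ {y ∈ P | f y = r})} :=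
    fun y hy => ⟨hr y hy, fun h => subset_convexHull ℝ _ ⟨hy, h⟩⟩
  exact (convexHull_min hsub hconv hx).2 hfx

theorem le_apply_of_mem_convexHull {E : Type*} [AddCommGroup E] [Module ℝ E] {P : Set E}
    (f : E →ₗ[ℝ] ℝ) {r : ℝ} (hr : ∀ x ∈ P, r ≤ f x) {x : E} (hx : x ∈ convexHull ℝ P) :
    r ≤ f x :=
  convexHull_min hr (convex_halfSpace_ge f.isLinear r) hx

theorem apply_eq_of_mem_convexHull {E : Type*} [AddCommGroup E] [Module ℝ E] {P : Set E}
    (f : E →ₗ[ℝ] ℝ) {r : ℝ} (hr : ∀ x ∈ P, f x = r) {x : E} (hx : x ∈ convexHull ℝ P) :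
    f x = r :=
  convexHull_min hr (convex_hyperplane f.isLinear r) hx

/-- Pairing with `(p, 1)`, as a linear functional on `ℝ^d × ℝ`. -/
noncomputable def heightPairing {d : ℕ} (p : Fin d → ℝ) : ((Fin d → ℝ) × ℝ) →ₗ[ℝ] ℝ where
  toFun z := z.2 + z.1 ⬝ᵥ p
  map_add' x y := by simp [add_dotProduct]; ring
  map_smul' r x := by simp [smul_dotProduct]; ring

theorem heightPairing_apply {d : ℕ} (p : Fin d → ℝ) (z : (Fin d → ℝ) × ℝ) :
    heightPairing p z = z.2 + z.1 ⬝ᵥ p := rfl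

/-- A linear functional on `ℝ^d × ℝ` in coordinates. -/
theorem exists_coordinates {d : ℕ} (l : StrongDual ℝ ((Fin d → ℝ) × ℝ)) :
    ∃ (w : Fin d → ℝ) (β : ℝ), ∀ z, l z = z.1 ⬝ᵥ w + β * z.2 := by
  refine ⟨fun i => l (Pi.single i 1, 0), l (0, 1), fun z => ?_⟩
  have h1 : z = (z.1, 0) + z.2 • ((0 : Fin d → ℝ), (1 : ℝ)) := by ext <;> simp
  have h2 : l (z.1, 0) = z.1 ⬝ᵥ fun i => l (Pi.single i 1, 0) := by
    have := LinearMap.pi_apply_eq_sum_univ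
      (l.toLinearMap ∘ₗ LinearMap.inl ℝ (Fin d → ℝ) ℝ) z.1
    have hs : ∀ i : Fin d, (fun j => if i = j then (1 : ℝ) else 0) = Pi.single i 1 := fun i => by
      ext j
      simp [Pi.single_apply, eq_comm]
    simp only [hs, smul_eq_mul] at this
    exact this
  conv_lhs => rw [h1]
  rw [map_add, map_smul, h2, smul_eq_mul, mul_comm]

/-- The dimensions of a subspace and of its orthogonal complement for the dot product add up
to `d`. -/
theorem finrank_add_finrank_dotProduct_orthogonal {d : ℕ} (V W : Submodule ℝ (Fin d → ℝ))
    (h : ∀ w, w ∈ W ↔ ∀ v ∈ V, v ⬝ᵥ w = 0) :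
    Module.finrank ℝ W + Module.finrank ℝ V = d := by
  have hW : W = LinearMap.BilinForm.orthogonal (dotProductBilin ℝ ℝ) V := by
    ext w
    rw [h]
    rfl
  have hker : LinearMap.ker (dotProductBilin ℝ ℝ : (Fin d → ℝ) →ₗ[ℝ] _ →ₗ[ℝ] ℝ) = ⊥ := by
    rw [LinearMap.ker_eq_bot']
    intro v hv
    exact dotProduct_self_eq_zero.1 (LinearMap.congr_fun hv v)
  have := LinearMap.BilinForm.finrank_add_finrank_orthogonal'
    (B := (dotProductBilin ℝ ℝ : LinearMap.BilinForm ℝ (Fin d → ℝ))) V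
  rw [← hW] at this
  have hbot : V ⊓ LinearMap.ker (dotProductBilin ℝ ℝ : LinearMap.BilinForm ℝ (Fin d → ℝ)) = ⊥ :=
    le_bot_iff.1 (inf_le_right.trans hker.le)
  rw [hbot, finrank_bot, Module.finrank_fin_fun] at this
  omega

/-! ### Argmin sets and the faces they determine -/

namespace PointConfiguration

variable {d : ℕ} {ι : Type} (a : ι → Fin d → ℝ) (c : ι → ℝ)

/-- The affine function `x ↦ c_i + a_i · x`. -/
def val (i : ι) (x : Fin d → ℝ) : ℝ := c i + a i ⬝ᵥ x

/-- The indices at which the minimum of `c_i + a_i · x` is attained. -/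
def argmin (x : Fin d → ℝ) : Set ι := {i | ∀ j, val a c i x ≤ val a c j x}

/-- The points below the graph of `x ↦ min_i (c_i + a_i · x)`. -/
def dome : Set ((Fin d → ℝ) × ℝ) := {q | ∀ i, q.2 ≤ val a c i q.1}

/-- The smallest face of the dome above `p`. -/
def domeFace (p : Fin d → ℝ) : Set ((Fin d → ℝ) × ℝ) :=
  {q ∈ dome a c | ∀ i ∈ argmin a c p, q.2 = val a c i q.1}

/-- The face of the extended Newton polyhedron on which `(p, 1)` is minimal. -/
def lowerFace (p : Fin d → ℝ) : Set ((Fin d → ℝ) × ℝ) :=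
  convexHull ℝ ((fun i => (a i, c i)) '' argmin a c p)

variable {a c}

theorem val_add_smul (i : ι) (x v : Fin d → ℝ) (t : ℝ) :
    val a c i (x + t • v) = val a c i x + t * (a i ⬝ᵥ v) := by
  simp only [val, dotProduct_add, dotProduct_smul, smul_eq_mul]; ring

theorem val_eq_of_mem_argmin {x : Fin d → ℝ} {i j : ι} (hi : i ∈ argmin a c x)
    (hj : j ∈ argmin a c x) : val a c i x = val a c j x :=
  le_antisymm (hi j) (hj i)

theorem mem_argmin_of_val_le {x : Fin d → ℝ} {i j : ι} (hi : i ∈ argmin a c x)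
    (h : val a c j x ≤ val a c i x) : j ∈ argmin a c x :=
  fun k => h.trans (hi k)

theorem argmin_nonempty [Finite ι] [Nonempty ι] (x : Fin d → ℝ) : (argmin a c x).Nonempty :=
  Finite.exists_min fun i => val a c i x

theorem mem_dome_of_mem_argmin {x : Fin d → ℝ} {i : ι} (hi : i ∈ argmin a c x) :
    (x, val a c i x) ∈ dome a c := hi

theorem mem_domeFace_self {x : Fin d → ℝ} {i : ι} (hi : i ∈ argmin a c x) :
    (x, val a c i x) ∈ domeFace a c x :=
  ⟨hi, fun _ hj => val_eq_of_mem_argmin hi hj⟩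

theorem argmin_subset_of_mem_domeFace {p : Fin d → ℝ} {q : (Fin d → ℝ) × ℝ}
    (hq : q ∈ domeFace a c p) : argmin a c p ⊆ argmin a c q.1 :=
  fun i hi j => (hq.2 i hi).symm.le.trans (hq.1 j)

theorem image_fst_domeFace [Finite ι] [Nonempty ι] (p : Fin d → ℝ) :
    Prod.fst '' domeFace a c p = {q | argmin a c p ⊆ argmin a c q} := by
  ext q
  constructor
  · rintro ⟨z, hz, rfl⟩
    exact argmin_subset_of_mem_domeFace hz
  · intro h
    obtain ⟨i, hi⟩ := argmin_nonempty (a := a) (c := c) p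
    exact ⟨(q, val a c i q), ⟨h hi, fun j hj => val_eq_of_mem_argmin (h hi) (h hj)⟩, rfl⟩

theorem image_fst_lowerFace (p : Fin d → ℝ) :
    Prod.fst '' lowerFace a c p = convexHull ℝ (a '' argmin a c p) := by
  have := (LinearMap.fst ℝ (Fin d → ℝ) ℝ).image_convexHull
    ((fun i => (a i, c i)) '' argmin a c p)
  rw [Set.image_image] at this
  exact this

theorem image_fst_domeFace_subset_iff [Finite ι] [Nonempty ι] {p q : Fin d → ℝ} :
    Prod.fst '' domeFace a c p ⊆ Prod.fst '' domeFace a c q ↔ argmin a c q ⊆ argmin a c p := by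
  rw [image_fst_domeFace, image_fst_domeFace]
  exact ⟨fun h => h (Set.Subset.refl (argmin a c p)), fun h x hx => h.trans hx⟩

theorem domeFace_subset_iff [Finite ι] [Nonempty ι] {p q : Fin d → ℝ} :
    domeFace a c p ⊆ domeFace a c q ↔ argmin a c q ⊆ argmin a c p :=
  ⟨fun h => image_fst_domeFace_subset_iff.1 (Set.image_mono h),
    fun h _ hx => ⟨hx.1, fun i hi => hx.2 i (h hi)⟩⟩

/-- Suppose `(a i, s)` lies in the face of `q`, with `i` minimal at `p`. Pairing with `(p, 1)` gives
`c i ≤ s`; pairing with `(q, 1)` shows that `s + a i ⬝ᵥ q` is the minimum at `q`. Hence `i` is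
minimal at `q` as well. -/
theorem image_fst_lowerFace_subset_iff [Finite ι] [Nonempty ι] {p q : Fin d → ℝ} :
    Prod.fst '' lowerFace a c p ⊆ Prod.fst '' lowerFace a c q ↔
      argmin a c p ⊆ argmin a c q := by
  constructor
  · intro h i hi
    have hmem : a i ∈ Prod.fst '' lowerFace a c p := by
      rw [image_fst_lowerFace]
      exact subset_convexHull ℝ _ ⟨i, hi, rfl⟩
    obtain ⟨⟨u, s⟩, hz, hzi⟩ := h hmem
    obtain rfl : u = a i := hzi
    obtain ⟨j, hj⟩ := argmin_nonempty (a := a) (c := c) q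
    have h1 : heightPairing q (a i, s) = val a c j q :=
      apply_eq_of_mem_convexHull _ (by
        rintro _ ⟨k, hk, rfl⟩
        exact val_eq_of_mem_argmin hk hj) hz
    have h2 : val a c i p ≤ heightPairing p (a i, s) :=
      le_apply_of_mem_convexHull _ (by
        rintro _ ⟨k, -, rfl⟩
        exact hi k) hz
    refine mem_argmin_of_val_le hj ?_
    simp only [heightPairing_apply, val] at *
    linarith
  · intro h
    exact Set.image_mono (convexHull_mono (Set.image_mono h))

theorem lowerFace_subset_iff [Finite ι] [Nonempty ι] {p q : Fin d → ℝ} :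
    lowerFace a c p ⊆ lowerFace a c q ↔ argmin a c p ⊆ argmin a c q :=
  ⟨fun h => image_fst_lowerFace_subset_iff.1 (Set.image_mono h),
    fun h => convexHull_mono (Set.image_mono h)⟩

theorem lowerFace_nonempty [Finite ι] [Nonempty ι] (p : Fin d → ℝ) :
    (lowerFace a c p).Nonempty :=
  ((argmin_nonempty p).image _).convexHull

theorem isBounded_lowerFace [Finite ι] (p : Fin d → ℝ) :
    Bornology.IsBounded (lowerFace a c p) :=
  isBounded_convexHull.2 ((Set.toFinite _).isBounded)

/-- Moving from `p` in a direction along which the minimal terms agree, these terms remain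
minimal for a while. -/
theorem exists_pos_argmin_subset [Finite ι] {p v : Fin d → ℝ} {s : ℝ}
    (h : ∀ i ∈ argmin a c p, a i ⬝ᵥ v = s) :
    ∃ ε > (0 : ℝ), argmin a c p ⊆ argmin a c (p + ε • v) := by
  have key : ∀ i ∈ argmin a c p, ∀ j, ∀ᶠ ε in nhdsWithin (0 : ℝ) (Set.Ioi 0),
      val a c i (p + ε • v) ≤ val a c j (p + ε • v) := by
    intro i hi j
    by_cases hj : j ∈ argmin a c p
    · refine Filter.Eventually.of_forall fun ε => ?_
      rw [val_add_smul, val_add_smul, h i hi, h j hj, val_eq_of_mem_argmin hi hj]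
    -- A term that is not minimal at `p` exceeds the minimum strictly, and by continuity it still
    -- does so for small `ε`.
    · have hlt : val a c i p < val a c j p := by
        by_contra hle
        exact hj (mem_argmin_of_val_le hi (not_lt.1 hle))
      have hcont : ∀ k, Filter.Tendsto (fun ε : ℝ => val a c k (p + ε • v)) (nhds 0)
          (nhds (val a c k p)) := by
        intro k
        have : Continuous fun ε : ℝ => val a c k p + ε * (a k ⬝ᵥ v) := by fun_prop
        simpa [val_add_smul] using this.tendsto 0
      exact (((hcont i).eventually_lt (hcont j) hlt).mono fun ε => le_of_lt).filter_mono
        nhdsWithin_le_nhds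
  have hall : ∀ᶠ ε in nhdsWithin (0 : ℝ) (Set.Ioi 0), ∀ i, i ∈ argmin a c p → ∀ j,
      val a c i (p + ε • v) ≤ val a c j (p + ε • v) := by
    rw [Filter.eventually_all]
    intro i
    by_cases hi : i ∈ argmin a c p
    · simpa [hi, Filter.eventually_all] using key i hi
    · simp [hi]
  obtain ⟨ε, hε, hε0⟩ := (hall.and self_mem_nhdsWithin).exists
  exact ⟨ε, hε0, fun i hi => hε i hi⟩

/-! ### Faces of the dome -/

/-- The exposing functional is the sum of `z.2 - a i ⬝ᵥ z.1` over the minimal terms at `p`. Each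
summand is at most `c i` on the dome, and all bounds are attained above `p`, so the sum is maximal
exactly where every summand is tight. -/
theorem isExposed_domeFace [Finite ι] [Nonempty ι] (p : Fin d → ℝ) :
    IsExposed ℝ (dome a c) (domeFace a c p) := by
  intro _
  classical
  have := Fintype.ofFinite ι
  let S : Finset ι := {i | i ∈ argmin a c p}
  have hS : ∀ i, i ∈ S ↔ i ∈ argmin a c p := fun i => by simp [S]
  let l : ((Fin d → ℝ) × ℝ) →ₗ[ℝ] ℝ :=
    { toFun := fun z => ∑ i ∈ S, (z.2 - a i ⬝ᵥ z.1)
      map_add' := fun x y => by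
        rw [← Finset.sum_add_distrib]
        exact Finset.sum_congr rfl fun i _ => by simp [dotProduct_add]; ring
      map_smul' := fun r x => by
        simp only [Finset.mul_sum, smul_eq_mul, RingHom.id_apply]
        exact Finset.sum_congr rfl fun i _ => by simp [dotProduct_smul]; ring }
  have hle : ∀ z ∈ dome a c, ∀ i ∈ S, z.2 - a i ⬝ᵥ z.1 ≤ c i := by
    intro z hz i _
    have := hz i
    simp only [val] at this
    linarith
  refine ⟨LinearMap.toContinuousLinearMap l, ?_⟩
  change _ = {x ∈ dome a c | ∀ y ∈ dome a c, ∑ i ∈ S, (y.2 - a i ⬝ᵥ y.1) ≤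
    ∑ i ∈ S, (x.2 - a i ⬝ᵥ x.1)}
  have heq : ∀ z ∈ domeFace a c p, ∀ i ∈ S, z.2 - a i ⬝ᵥ z.1 = c i := by
    intro z hz i hi
    have := hz.2 i ((hS i).1 hi)
    simp only [val] at this
    linarith
  ext x
  constructor
  · intro hx
    refine ⟨hx.1, fun y hy => ?_⟩
    rw [Finset.sum_congr rfl (heq x hx)]
    exact Finset.sum_le_sum (hle y hy)
  · rintro ⟨hx, hmax⟩
    refine ⟨hx, fun i hi => ?_⟩
    have h1 := hmax _ (mem_domeFace_self hi).1
    rw [Finset.sum_congr rfl (heq _ (mem_domeFace_self hi))] at h1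
    have h2 := (Finset.sum_eq_sum_iff_of_le (hle x hx)).1
      (le_antisymm (Finset.sum_le_sum (hle x hx)) h1) i ((hS i).2 hi)
    simp only [val]
    linarith

theorem domeFace_ne_dome [Finite ι] [Nonempty ι] (p : Fin d → ℝ) :
    domeFace a c p ≠ dome a c := by
  obtain ⟨i, hi⟩ := argmin_nonempty (a := a) (c := c) p
  intro h
  have h1 : (p, val a c i p - 1) ∈ dome a c := fun j => by
    have := hi j
    dsimp only
    linarith
  rw [← h] at h1
  have := h1.2 i hi
  dsimp only at this
  linarith

theorem domeFace_nonempty [Finite ι] [Nonempty ι] (p : Fin d → ℝ) :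
    (domeFace a c p).Nonempty :=
  let ⟨_, hi⟩ := argmin_nonempty p
  ⟨_, mem_domeFace_self hi⟩

/-- The nonempty faces of the dome are the dome and the faces `domeFace a c p`. -/
theorem eq_dome_or_eq_domeFace [Finite ι] [Nonempty ι] {G : Set ((Fin d → ℝ) × ℝ)}
    (hG : IsExposed ℝ (dome a c) G) (hne : G.Nonempty) :
    G = dome a c ∨ ∃ p, G = domeFace a c p := by
  obtain ⟨l, rfl⟩ := hG hne
  obtain ⟨w, β, hl⟩ := exists_coordinates l
  obtain ⟨⟨p, s⟩, hp, hmax⟩ := hne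
  have hβ : 0 ≤ β := by
    have h1 : (p, s - 1) ∈ dome a c := fun i => by
      have := hp i
      dsimp only at this ⊢
      linarith
    have := hmax _ h1
    simp only [hl] at this
    linarith
  rcases hβ.eq_or_lt with rfl | hβ
  · left
    -- A functional without height component is bounded above on all of `ℝ^d`, hence zero, and the
    -- face is the whole dome.
    have hle : ∀ q, q ⬝ᵥ w ≤ p ⬝ᵥ w := by
      intro q
      obtain ⟨i, hi⟩ := argmin_nonempty (a := a) (c := c) q
      simpa [hl] using hmax _ (mem_dome_of_mem_argmin hi)
    have h0 : ∀ q, q ⬝ᵥ w = 0 := by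
      intro q
      have h1 := hle (p + q)
      have h2 := hle (p - q)
      rw [add_dotProduct] at h1
      rw [sub_dotProduct] at h2
      linarith
    ext z
    simp [hl, h0]
  · right
    set G := {x ∈ dome a c | ∀ y ∈ dome a c, l y ≤ l x} with hGdef
    have htop : ∀ z ∈ G, ∀ i ∈ argmin a c z.1, z.2 = val a c i z.1 := by
      intro z hz i hi
      refine le_antisymm (hz.1 i) ?_
      have := hz.2 _ (mem_dome_of_mem_argmin hi)
      simp only [hl] at this
      exact le_of_mul_le_mul_left (by linarith) hβ
    have hne : ((fun z : (Fin d → ℝ) × ℝ => argmin a c z.1) '' G).Nonempty :=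
      ⟨_, _, ⟨hp, hmax⟩, rfl⟩
    -- A point of `G` with inclusion-minimal argmin plays the role of a relative interior point.
    obtain ⟨_, ⟨⟨x, hx, rfl⟩, hmin⟩⟩ := (Set.toFinite _).exists_minimal hne
    refine ⟨x.1, Set.Subset.antisymm ?_ ?_⟩
    · intro z hz
      refine ⟨hz.1, ?_⟩
      -- The midpoint of `x` and `z` lies in `G`. A term tight at the midpoint is tight at both
      -- ends, so minimality of the argmin of `x` makes every term minimal at `x` tight at `z`.
      let y : (Fin d → ℝ) × ℝ := (x.1 + (1 / 2 : ℝ) • (z.1 - x.1), (x.2 + z.2) / 2)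
      have hval : ∀ i, val a c i y.1 = (val a c i x.1 + val a c i z.1) / 2 := by
        intro i
        simp only [y]
        rw [val_add_smul, dotProduct_sub]
        simp only [val]
        ring
      have hyd : y ∈ dome a c := fun i => by
        rw [hval]
        have h1 := hx.1 i
        have h2 := hz.1 i
        simp only [y]
        linarith
      have hly : l y = (l x + l z) / 2 := by
        simp only [hl, y, add_dotProduct, smul_dotProduct, sub_dotProduct, smul_eq_mul]
        ring
      have hy : y ∈ G := ⟨hyd, fun u hu => by
        rw [hly]
        linarith [hx.2 u hu, hz.2 u hu]⟩
      have hboth : ∀ i ∈ argmin a c y.1, x.2 = val a c i x.1 ∧ z.2 = val a c i z.1 := by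
        intro i hi
        have h1 := hx.1 i
        have h2 := hz.1 i
        have h3 := htop y hy i hi
        rw [hval] at h3
        simp only [y] at h3
        constructor <;> linarith
      have hsub : argmin a c y.1 ⊆ argmin a c x.1 := fun i hi j =>
        (hboth i hi).1.symm.le.trans (hx.1 j)
      intro i hi
      exact (hboth i (hmin ⟨y, hy, rfl⟩ hsub hi)).2
    · intro q hq
      refine ⟨hq.1, fun y hy => ?_⟩
      -- The segment from `q` to `x` can be prolonged slightly beyond `x` within the dome, since the
      -- terms minimal at `x` share the slope `x.2 - q.2`. Maximality of `l` at `x` then forces `l x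
      -- ≤ l q`.
      have hdir : ∀ i ∈ argmin a c x.1, a i ⬝ᵥ (x.1 - q.1) = x.2 - q.2 := by
        intro i hi
        rw [htop x hx i hi, hq.2 i hi, dotProduct_sub]
        simp only [val]
        ring
      obtain ⟨ε, hε, hsub⟩ := exists_pos_argmin_subset hdir
      obtain ⟨i, hi⟩ := argmin_nonempty (a := a) (c := c) x.1
      have h1 := hx.2 _ (mem_dome_of_mem_argmin (hsub hi))
      rw [val_add_smul, hdir i hi, ← htop x hx i hi] at h1
      have h2 : l x ≤ l q := by
        simp only [hl, add_dotProduct, smul_dotProduct, sub_dotProduct, smul_eq_mul] at h1 ⊢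
        refine le_of_mul_le_mul_left ?_ hε
        linarith
      exact (hx.2 y hy).trans h2

/-! ### Bounded faces of the extended polyhedron -/

theorem mem_extPolyhedron_iff {z : (Fin d → ℝ) × ℝ} :
    z ∈ extPolyhedron a c ↔ ∃ u ∈ convexHull ℝ (Set.range fun i => (a i, c i)), ∃ t : ℝ,
      0 ≤ t ∧ z = u + (0, t) := by
  constructor
  · rintro ⟨u, hu, ⟨v, t⟩, ⟨hv, ht⟩, rfl⟩
    dsimp only at hv ht
    subst hv
    exact ⟨u, hu, t, ht, rfl⟩
  · rintro ⟨u, hu, t, ht, rfl⟩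
    exact ⟨u, hu, (0, t), ⟨rfl, ht⟩, rfl⟩

theorem val_le_heightPairing {p : Fin d → ℝ} {i : ι} (hi : i ∈ argmin a c p)
    {z : (Fin d → ℝ) × ℝ} (hz : z ∈ extPolyhedron a c) : val a c i p ≤ heightPairing p z := by
  obtain ⟨u, hu, t, ht, rfl⟩ := mem_extPolyhedron_iff.1 hz
  have := le_apply_of_mem_convexHull (heightPairing p) (r := val a c i p)
    (by rintro _ ⟨j, rfl⟩; exact hi j) hu
  simp only [heightPairing_apply, Prod.fst_add, Prod.snd_add, add_zero] at this ⊢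
  linarith

theorem lowerFace_eq [Finite ι] [Nonempty ι] (p : Fin d → ℝ) :
    lowerFace a c p = {x ∈ extPolyhedron a c | ∀ y ∈ extPolyhedron a c,
      heightPairing p x ≤ heightPairing p y} := by
  obtain ⟨i, hi⟩ := argmin_nonempty (a := a) (c := c) p
  ext z
  constructor
  · intro hz
    refine ⟨mem_extPolyhedron_iff.2 ⟨z, convexHull_mono (Set.image_subset_range _ _) hz, 0,
      le_rfl, by simp⟩, fun y hy => ?_⟩
    rw [apply_eq_of_mem_convexHull (heightPairing p) (r := val a c i p) (by
      rintro _ ⟨j, hj, rfl⟩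
      exact val_eq_of_mem_argmin hj hi) hz]
    exact val_le_heightPairing hi hy
  · rintro ⟨hz, hmin⟩
    have h1 : heightPairing p z ≤ val a c i p := hmin (a i, c i)
      (mem_extPolyhedron_iff.2 ⟨_, subset_convexHull ℝ _ ⟨i, rfl⟩, 0, le_rfl, by simp⟩)
    obtain ⟨u, hu, t, ht, rfl⟩ := mem_extPolyhedron_iff.1 hz
    have hr : ∀ x ∈ Set.range fun i => (a i, c i), val a c i p ≤ heightPairing p x := by
      rintro _ ⟨j, rfl⟩
      exact hi j
    have h2 := le_apply_of_mem_convexHull (heightPairing p) hr hu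
    have h3 : heightPairing p (u + (0, t)) = heightPairing p u + t := by
      simp only [heightPairing_apply, Prod.fst_add, Prod.snd_add, add_zero]
      ring
    -- A vertical shift by `t` raises the pairing by `t`, so a minimizer has none and lies in the
    -- convex hull itself.
    obtain rfl : t = 0 := by linarith
    have h4 := mem_convexHull_of_apply_eq (heightPairing p) hr hu (by linarith)
    have h5 : u + ((0 : Fin d → ℝ), (0 : ℝ)) = u := by simp
    rw [h5]
    refine convexHull_mono ?_ h4
    rintro _ ⟨⟨j, rfl⟩, hj⟩
    exact ⟨j, mem_argmin_of_val_le hi hj.le, rfl⟩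

theorem isExposed_lowerFace [Finite ι] [Nonempty ι] (p : Fin d → ℝ) :
    IsExposed ℝ (extPolyhedron a c) (lowerFace a c p) := by
  intro _
  refine ⟨LinearMap.toContinuousLinearMap (-heightPairing p), ?_⟩
  rw [lowerFace_eq]
  simp

/-- The nonempty bounded faces of the extended polyhedron are the faces `lowerFace a c p`. -/
theorem exists_eq_lowerFace [Finite ι] [Nonempty ι] {H : Set ((Fin d → ℝ) × ℝ)}
    (hH : IsExposed ℝ (extPolyhedron a c) H) (hne : H.Nonempty) (hb : Bornology.IsBounded H) :
    ∃ p, H = lowerFace a c p := by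
  obtain ⟨l, rfl⟩ := hH hne
  obtain ⟨w, β, hl⟩ := exists_coordinates l
  obtain ⟨x, hx, hmax⟩ := hne
  have hup : ∀ t : ℝ, 0 ≤ t → x + (0, t) ∈ extPolyhedron a c := by
    intro t ht
    obtain ⟨u, hu, s, hs, rfl⟩ := mem_extPolyhedron_iff.1 hx
    exact mem_extPolyhedron_iff.2 ⟨u, hu, s + t, add_nonneg hs ht, by simp [add_assoc]⟩
  have hlup : ∀ t : ℝ, l (x + (0, t)) = l x + β * t := by
    intro t
    simp only [hl, Prod.fst_add, Prod.snd_add, add_zero]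
    ring
  have hβ : β ≤ 0 := by
    have := hmax _ (hup 1 zero_le_one)
    rw [hlup] at this
    linarith
  rcases hβ.eq_or_lt with rfl | hβ
  -- If `l` ignores the height, the face contains the vertical ray above `x` and is unbounded.
  · exfalso
    obtain ⟨R, hR⟩ := hb.exists_norm_le
    have h1 : ∀ t : ℝ, 0 ≤ t → |x.2 + t| ≤ R := by
      intro t ht
      refine le_trans ?_ (hR (x + (0, t)) ⟨hup t ht, fun y hy => ?_⟩)
      · exact norm_snd_le (x + (0, t))
      · rw [hlup]
        simpa using hmax y hy
    -- This height makes `x.2 + t` at least `|R| + 1`, beyond the norm bound `R`.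
    have h2 := h1 (|R| + |x.2| + 1) (by positivity)
    linarith [le_abs_self (x.2 + (|R| + |x.2| + 1)), le_abs_self R, neg_abs_le x.2]
  -- Dividing by the negative `β` normalizes the functional to `(p, 1)` and turns maximization into
  -- minimization.
  · refine ⟨β⁻¹ • w, ?_⟩
    rw [lowerFace_eq]
    have h1 : ∀ z, l z = β * heightPairing (β⁻¹ • w) z := by
      intro z
      rw [hl, heightPairing_apply, dotProduct_smul, smul_eq_mul, mul_add,
        mul_inv_cancel_left₀ hβ.ne, add_comm]
    ext z
    simp only [Set.mem_ofPred_eq, h1, mul_le_mul_left_of_neg hβ]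

/-! ### Orthogonality and dimensions of dual cells -/

/-- The direction space of a cell of the normal complex is the orthogonal complement of that of
the dual cell. -/
theorem mem_vectorSpan_image_fst_domeFace [Finite ι] [Nonempty ι] (p v : Fin d → ℝ) :
    v ∈ vectorSpan ℝ (Prod.fst '' domeFace a c p) ↔
      ∀ u ∈ vectorSpan ℝ (Prod.fst '' lowerFace a c p), u ⬝ᵥ v = 0 := by
  have hspan : vectorSpan ℝ (Prod.fst '' lowerFace a c p) =
      vectorSpan ℝ (a '' argmin a c p) := by
    rw [image_fst_lowerFace, ← direction_affineSpan, affineSpan_convexHull,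
      direction_affineSpan]
  rw [hspan, image_fst_domeFace]
  constructor
  · intro hv u hu
    have h1 : vectorSpan ℝ (a '' argmin a c p) ≤
        LinearMap.ker ((dotProductBilin ℝ ℝ).flip v) := by
      rw [vectorSpan_def, Submodule.span_le]
      rintro _ ⟨_, ⟨i, hi, rfl⟩, _, ⟨j, hj, rfl⟩, rfl⟩
      -- On the cell the terms `i` and `j` agree, so `(a i - a j) ⬝ᵥ x` is constant there.
      have h2 : vectorSpan ℝ {q | argmin a c p ⊆ argmin a c q} ≤
          LinearMap.ker (dotProductBilin ℝ ℝ (a i - a j)) := by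
        rw [vectorSpan_def, Submodule.span_le]
        rintro _ ⟨x, hx, y, hy, rfl⟩
        have hx' := val_eq_of_mem_argmin (hx hi) (hx hj)
        have hy' := val_eq_of_mem_argmin (hy hi) (hy hj)
        change (a i - a j) ⬝ᵥ (x - y) = 0
        simp only [val] at hx' hy'
        rw [sub_dotProduct, dotProduct_sub, dotProduct_sub]
        linarith
      exact h2 hv
    exact h1 hu
  · intro h
    obtain ⟨i, hi⟩ := argmin_nonempty (a := a) (c := c) p
    have hdir : ∀ j ∈ argmin a c p, a j ⬝ᵥ v = a i ⬝ᵥ v := by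
      intro j hj
      have := h _ (vsub_mem_vectorSpan ℝ (Set.mem_image_of_mem a hj)
        (Set.mem_image_of_mem a hi))
      rwa [vsub_eq_sub, sub_dotProduct, sub_eq_zero] at this
    -- Along an orthogonal direction the minimal terms vary equally, so a short step from `p` stays
    -- in its cell.
    obtain ⟨ε, hε, hsub⟩ := exists_pos_argmin_subset hdir
    have h1 : (p + ε • v) -ᵥ p ∈ vectorSpan ℝ {q | argmin a c p ⊆ argmin a c q} :=
      vsub_mem_vectorSpan ℝ hsub (Set.Subset.refl (argmin a c p))
    rw [vsub_eq_sub, add_sub_cancel_left] at h1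
    exact (Submodule.smul_mem_iff _ hε.ne').1 h1

theorem cellDim_add_cellDim [Finite ι] [Nonempty ι] (p : Fin d → ℝ) :
    cellDim (Prod.fst '' domeFace a c p) + cellDim (Prod.fst '' lowerFace a c p) = d :=
  finrank_add_finrank_dotProduct_orthogonal _ _ (mem_vectorSpan_image_fst_domeFace p)

theorem dotProduct_sub_eq_zero [Finite ι] [Nonempty ι] {p x y u v : Fin d → ℝ}
    (hx : x ∈ Prod.fst '' domeFace a c p) (hy : y ∈ Prod.fst '' domeFace a c p)
    (hu : u ∈ Prod.fst '' lowerFace a c p) (hv : v ∈ Prod.fst '' lowerFace a c p) :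
    (u - v) ⬝ᵥ (x - y) = 0 :=
  (mem_vectorSpan_image_fst_domeFace p _).1 (vsub_mem_vectorSpan ℝ hx hy) _
    (vsub_mem_vectorSpan ℝ hu hv)

theorem cellDim_pos_iff (ha : Function.Injective a) (p : Fin d → ℝ) :
    0 < cellDim (Prod.fst '' lowerFace a c p) ↔ (argmin a c p).Nontrivial := by
  rw [cellDim, image_fst_lowerFace, ← direction_affineSpan, affineSpan_convexHull,
    direction_affineSpan, Nat.pos_iff_ne_zero, Ne, Submodule.finrank_eq_zero,
    vectorSpan_eq_bot_iff_subsingleton, Set.not_subsingleton_iff, Set.image_nontrivial ha]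

theorem cellDim_lt_iff [Finite ι] [Nonempty ι] (ha : Function.Injective a) (p : Fin d → ℝ) :
    cellDim (Prod.fst '' domeFace a c p) < d ↔ (argmin a c p).Nontrivial := by
  rw [← cellDim_pos_iff ha]
  have := cellDim_add_cellDim (a := a) (c := c) p
  omega

end PointConfiguration

/-! ### Translation from tropical polynomials to point configurations -/

namespace TropPoly

open PointConfiguration

variable {d : ℕ} (F : TropPoly d)

/-- The exponents of `F` as points of `ℝ^d`. -/
def exponent (m : F.supp) : Fin d → ℝ := toPoint (m : Fin d → ℤ)

theorem exponent_injective : Function.Injective F.exponent := by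
  intro m m' h
  ext i
  have := congrFun h i
  simpa [exponent, toPoint] using this

theorem term_eq (m : F.supp) (x : Fin d → ℝ) :
    F.term m x = Tropical.trop ((val F.exponent F.realCoeff m x : ℝ) : WithTop ℝ) := by
  have hm : F.coeff (m : Fin d → ℤ) ≠ 0 := Finsupp.mem_support_iff.1 m.2
  have hne : Tropical.untrop (F.coeff (m : Fin d → ℤ)) ≠ ⊤ := fun h =>
    hm (Tropical.untrop_injective (h.trans Tropical.untrop_zero.symm))
  apply Tropical.untrop_injective
  rw [term, Tropical.untrop_mul, Tropical.untrop_trop, Tropical.untrop_trop, val,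
    WithTop.coe_add]
  obtain ⟨r, hr⟩ := WithTop.ne_top_iff_exists.1 hne
  rw [realCoeff, ← hr]
  rfl

theorem le_eval_iff (t : Tropical (WithTop ℝ)) (x : Fin d → ℝ) :
    t ≤ F.eval x ↔ ∀ m : F.supp, t ≤ F.term m x := by
  rw [← Tropical.untrop_le_iff, eval, Finset.untrop_sum', Finset.le_inf_iff]
  simp [Tropical.untrop_le_iff]

theorem dome_eq : F.dome = PointConfiguration.dome F.exponent F.realCoeff := by
  ext q
  have := F.le_eval_iff (Tropical.trop (q.2 : WithTop ℝ)) q.1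
  simp only [term_eq, ← Tropical.untrop_le_iff, Tropical.untrop_trop, WithTop.coe_le_coe] at this
  exact this

theorem mem_hypersurface_iff (x : Fin d → ℝ) :
    x ∈ F.hypersurface ↔ (argmin F.exponent F.realCoeff x).Nontrivial := by
  have key : ∀ m : F.supp, F.term m x = F.eval x ↔ m ∈ argmin F.exponent F.realCoeff x := by
    intro m
    have h1 : F.eval x ≤ F.term m x := (F.le_eval_iff _ x).1 le_rfl m
    rw [← h1.ge_iff_eq', le_eval_iff]
    simp only [term_eq, ← Tropical.untrop_le_iff, Tropical.untrop_trop, WithTop.coe_le_coe]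
    rfl
  constructor
  · rintro ⟨m, hm, m', hm', hne, h, h'⟩
    exact ⟨⟨m, hm⟩, (key ⟨m, hm⟩).1 h, ⟨m', hm'⟩, (key ⟨m', hm'⟩).1 h',
      fun e => hne (congrArg Subtype.val e)⟩
  · rintro ⟨m, hm, m', hm', hne⟩
    exact ⟨m, m.2, m', m'.2, fun e => hne (Subtype.ext e), (key m).2 hm, (key m').2 hm'⟩

end TropPoly

/-! ### The duality -/

open PointConfiguration in
theorem mainTheorem8 (d : ℕ) (F : TropPoly d) (hF : F.supp.Nonempty) :
    -- the inclusion-reversing bijection between the faces of the dome and the bounded faces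
    ∃ Φ : F.DomeFace ≃o F.BoundedNewtonFace ᵒᵈ,
    -- it projects to an inclusion-reversing bijection of the cells of the normal complex
    -- with the cells of the regular subdivision
    ∃ Ψ : F.normalComplex ≃o F.subdivision ᵒᵈ,
      (∀ (G : F.DomeFace) (σ : F.normalComplex), G.1 ≠ F.dome → σ.1 = Prod.fst '' G.1 →
        (OrderDual.ofDual (Ψ σ)).1 = Prod.fst '' (OrderDual.ofDual (Φ G)).1) ∧
      -- dual cells have complementary dimensions and are orthogonal
      (∀ σ : F.normalComplex, cellDim σ.1 + cellDim (OrderDual.ofDual (Ψ σ)).1 = d) ∧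
      (∀ σ : F.normalComplex, ∀ x ∈ σ.1, ∀ y ∈ σ.1,
        ∀ u ∈ (OrderDual.ofDual (Ψ σ)).1, ∀ v ∈ (OrderDual.ofDual (Ψ σ)).1,
          (u - v) ⬝ᵥ (x - y) = 0) ∧
      -- the hypersurface is the codimension-one skeleton of the normal complex, and its cells
      -- correspond to the positive-dimensional cells of the subdivision
      F.hypersurface = ⋃₀ {σ | σ ∈ F.normalComplex ∧ cellDim σ < d} ∧
      (∀ σ : F.normalComplex,
        σ.1 ⊆ F.hypersurface ↔ 0 < cellDim (OrderDual.ofDual (Ψ σ)).1) := by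
  have : Nonempty F.supp := hF.to_subtype
  have hdome := F.dome_eq
  let a := F.exponent
  let c := F.realCoeff
  have ha : Function.Injective a := F.exponent_injective
  -- The index `none` stands for the extra pair formed by the dome and the empty face.
  let f : Option (Fin d → ℝ) → F.DomeFace := fun o => o.elim
    ⟨F.dome, IsExposed.refl _, hdome ▸ (domeFace_nonempty 0).mono fun _ h => h.1⟩
    fun p => ⟨domeFace a c p, hdome ▸ isExposed_domeFace p, domeFace_nonempty p⟩
  let g : Option (Fin d → ℝ) → F.BoundedNewtonFace ᵒᵈ := fun o => OrderDual.toDual (o.elim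
    ⟨∅, isExposed_empty, Bornology.isBounded_empty⟩
    fun p => ⟨lowerFace a c p, isExposed_lowerFace p, isBounded_lowerFace p⟩)
  have hf : Function.Surjective f := by
    rintro ⟨G, hG, hne⟩
    rcases eq_dome_or_eq_domeFace (hdome ▸ hG) hne with h | ⟨p, h⟩
    · exact ⟨none, Subtype.ext (hdome.trans h.symm)⟩
    · exact ⟨some p, Subtype.ext h.symm⟩
  have hg : Function.Surjective g := by
    rintro ⟨H, hH, hb⟩
    rcases H.eq_empty_or_nonempty with h | hne
    · exact ⟨none, Subtype.ext h.symm⟩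
    · obtain ⟨p, h⟩ := exists_eq_lowerFace hH hne hb
      exact ⟨some p, Subtype.ext h.symm⟩
  obtain ⟨Φ, hΦ⟩ := exists_orderIso_of_parametrization f g hf hg (by
    have hsub : ∀ p, domeFace a c p ⊆ F.dome := fun p => hdome ▸ fun _ h => h.1
    rintro (_ | p) (_ | q)
    · exact iff_of_true le_rfl le_rfl
    · refine iff_of_false (fun h => ?_) fun h => ?_
      · exact domeFace_ne_dome q ((hsub q).antisymm h |>.trans hdome)
      · exact (lowerFace_nonempty q).not_subset_empty h
    · exact iff_of_true (hsub p) (Set.empty_subset _)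
    · exact domeFace_subset_iff.trans lowerFace_subset_iff.symm)
  let f' : (Fin d → ℝ) → F.normalComplex := fun p =>
    ⟨Prod.fst '' domeFace a c p, domeFace a c p, hdome ▸ isExposed_domeFace p,
      domeFace_nonempty p, hdome ▸ domeFace_ne_dome p, rfl⟩
  let g' : (Fin d → ℝ) → F.subdivision ᵒᵈ := fun p => OrderDual.toDual
    ⟨Prod.fst '' lowerFace a c p, lowerFace a c p, isExposed_lowerFace p,
      lowerFace_nonempty p, isBounded_lowerFace p, rfl⟩
  have hf' : Function.Surjective f' := by
    rintro ⟨_, G, hG, hne, hproper, rfl⟩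
    rcases eq_dome_or_eq_domeFace (hdome ▸ hG) hne with h | ⟨p, h⟩
    · exact absurd (h.trans hdome.symm) hproper
    · exact ⟨p, Subtype.ext (congrArg (Prod.fst '' ·) h.symm)⟩
  have hg' : Function.Surjective g' := by
    rintro ⟨_, H, hH, hne, hb, rfl⟩
    obtain ⟨p, h⟩ := exists_eq_lowerFace hH hne hb
    exact ⟨p, Subtype.ext (congrArg (Prod.fst '' ·) h.symm)⟩
  obtain ⟨Ψ, hΨ⟩ := exists_orderIso_of_parametrization f' g' hf' hg' fun p q =>
    image_fst_domeFace_subset_iff.trans image_fst_lowerFace_subset_iff.symm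
  refine ⟨Φ, Ψ, ?_, ?_, ?_, ?_, ?_⟩
  · intro G σ hG hσ
    obtain ⟨_ | p, rfl⟩ := hf G
    · exact absurd rfl hG
    · obtain rfl : σ = f' p := Subtype.ext hσ
      rw [hΦ, hΨ]
      rfl
  · intro σ
    obtain ⟨p, rfl⟩ := hf' σ
    rw [hΨ]
    exact cellDim_add_cellDim p
  · intro σ x hx y hy u hu v hv
    obtain ⟨p, rfl⟩ := hf' σ
    rw [hΨ] at hu hv
    exact dotProduct_sub_eq_zero hx hy hu hv
  · ext x
    rw [F.mem_hypersurface_iff]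
    constructor
    · intro hx
      -- Each point of the hypersurface lies in its own cell, whose dimension is below `d`.
      refine ⟨(f' x).1, ⟨(f' x).2, (cellDim_lt_iff ha x).2 hx⟩, ?_⟩
      change x ∈ Prod.fst '' domeFace a c x
      rw [image_fst_domeFace]
      exact Set.Subset.refl (argmin a c x)
    · rintro ⟨σ, ⟨hσ, hdim⟩, hx⟩
      obtain ⟨p, hp⟩ := hf' ⟨σ, hσ⟩
      obtain rfl : Prod.fst '' domeFace a c p = σ := congrArg Subtype.val hp
      rw [image_fst_domeFace] at hx
      exact ((cellDim_lt_iff ha p).1 hdim).mono hx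
  · intro σ
    obtain ⟨p, rfl⟩ := hf' σ
    rw [hΨ]
    refine Iff.trans ?_ (cellDim_pos_iff ha p).symm
    change Prod.fst '' domeFace a c p ⊆ _ ↔ _
    rw [image_fst_domeFace]
    exact ⟨fun h => (F.mem_hypersurface_iff p).1 (h (Set.Subset.refl (argmin a c p))),
      fun h x hx => (F.mem_hypersurface_iff x).2 (h.mono hx)⟩
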